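/- Let $\mathbb N=\{0,1,2,\ldots\}$. For an integer $m\ge 3$ and $n\in\mathbb N$, let $$\bar p_m(n)=\frac{n\big((m-2)n+(m-4)\big)}2$$ be the second $m$-gonal numbers; thus $\bar p_5(n)=\frac{n(3n+1)}2$ and $\bar p_7(n)=\frac{n(5n+3)}2$. Then $$\{\bar p_5(w)+\bar p_5(x)+\bar p_5(y)+\bar p_5(z):\ w,x,y,z\in\mathbb N\}=\mathbb N\setminus\{1,3,5,10,12,20,25,27,38,53,65,153,165\}.$$ Also, any integer $n\ge 786$ can be written as $\bar p_7(w)+\bar p_7(x)+\bar p_7(y)+\bar p_7(z)$ with $w,x,y,z\in\mathbb N$. -/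

import Mathlib

/-- The polygonal number `p_m(x) = x ((m - 2) x - (m - 4)) / 2` of order `m`, at any integer `x`.
The integer division is exact, see `two_mul_polygonalNumber`. -/
def polygonalNumber (m x : ℤ) : ℤ := x * ((m - 2) * x - (m - 4)) / 2

/-- The second `m`-gonal number `p_m(-n) = n ((m - 2) n + (m - 4)) / 2`, for natural `n`. -/
def secondPolygonalNumber (m : ℤ) (n : ℕ) : ℤ := polygonalNumber m (-(n : ℤ))

theorem two_mul_polygonalNumber (m x : ℤ) :
    2 * polygonalNumber m x = x * ((m - 2) * x - (m - 4)) := by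
  unfold polygonalNumber
  apply Int.mul_ediv_cancel'
  have h : x * ((m - 2) * x - (m - 4)) = (m - 2) * (x * (x - 1)) + 2 * x := by ring
  rw [h]
  exact dvd_add (Dvd.dvd.mul_left (Int.even_mul_pred_self x).two_dvd _) (dvd_mul_right _ _)

theorem two_mul_secondPolygonalNumber (m : ℤ) (n : ℕ) :
    2 * secondPolygonalNumber m n = n * ((m - 2) * n + (m - 4)) := by
  unfold secondPolygonalNumber
  rw [two_mul_polygonalNumber]
  ring

/-! Twice a sum of four second `m`-gonal numbers is `(m - 2) a + (m - 4) b`, where `a` is the sum of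
the squares of the arguments and `b` their sum. Cauchy's lemma realises odd `a`, `b` with roughly
`√(3a) < b < 2√a`. For large `n` this window for `b` is long enough to contain the residue class
that makes `a` an odd integer; the remaining `n` are checked by computation. Cauchy's lemma rests on
three squares for `n ≡ 3 mod 8`, proved by Dirichlet's method: `n` is a value of a ternary form of
determinant 1, which reduces to a sum of three squares. -/

theorem exists_two_mul_add_mul_sq_le (a f : ℤ) (ha : 0 < a) :
    ∃ k : ℤ, (2 * (f + k * a)) ^ 2 ≤ a ^ 2 := by
  refine ⟨-((2 * f + a) / (2 * a)), ?_⟩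
  have h1 := Int.emod_nonneg (2 * f + a) (b := 2 * a) (by positivity)
  have h2 := Int.emod_lt_of_pos (2 * f + a) (b := 2 * a) (by positivity)
  have h3 := Int.emod_add_mul_ediv (2 * f + a) (2 * a)
  apply sq_le_sq' <;> linarith

/-- A positive definite integral binary form `p x² + 2 q x y + r y²` of determinant `D` takes,
at a primitive vector, a value `m` with `3 m² ≤ 4 D`. -/
theorem exists_isCoprime_binary_form_small (p q r : ℤ) (hp : 0 < p) (hD : 0 < p * r - q ^ 2) :
    ∃ α γ : ℤ, IsCoprime α γ ∧
      3 * (p * α ^ 2 + 2 * q * α * γ + r * γ ^ 2) ^ 2 ≤ 4 * (p * r - q ^ 2) := by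
  induction hn : p.toNat using Nat.strong_induction_on generalizing p q r with
  | _ n ih =>
    by_cases hs : 3 * p ^ 2 ≤ 4 * (p * r - q ^ 2)
    · exact ⟨1, 0, isCoprime_one_left, by simpa using hs⟩
    push Not at hs
    obtain ⟨k, hk⟩ := exists_two_mul_add_mul_sq_le p q hp
    have hdet : p * (p * k ^ 2 + 2 * q * k + r) - (q + k * p) ^ 2 = p * r - q ^ 2 := by ring
    have hrpos : 0 < p * k ^ 2 + 2 * q * k + r := by
      by_contra! h
      nlinarith [sq_nonneg (q + k * p)]
    have hrlt : p * k ^ 2 + 2 * q * k + r < p := by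
      by_contra! h
      nlinarith
    obtain ⟨α, γ, hc, hle⟩ := ih (p * k ^ 2 + 2 * q * k + r).toNat (by omega)
      (p * k ^ 2 + 2 * q * k + r) (-(q + k * p)) p hrpos (by nlinarith) rfl
    refine ⟨k * α - γ, α, ?_, ?_⟩
    · obtain ⟨u, v, huv⟩ := hc
      exact ⟨-v, u + v * k, by linear_combination huv⟩
    · convert hle using 1 <;> ring

/-- Every value of a positive definite integral ternary form of determinant `1` is a sum of
three squares. -/
theorem ternary_form_eq_sum_three_sq (a b c d e f : ℤ) (ha : 0 < a) (hab : 0 < a * b - f ^ 2)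
    (hdet : a * b * c + 2 * d * e * f - a * d ^ 2 - b * e ^ 2 - c * f ^ 2 = 1) (x y z : ℤ) :
    ∃ u v w : ℤ, a * x ^ 2 + b * y ^ 2 + c * z ^ 2 + 2 * d * y * z + 2 * e * x * z
      + 2 * f * x * y = u ^ 2 + v ^ 2 + w ^ 2 := by
  induction hn : a.toNat using Nat.strong_induction_on generalizing a b c d e f x y z with
  | _ n ih =>
    -- Completing the square in `x` leaves a binary form of determinant `a`. A small primitive
    -- vector of it becomes the second basis vector.
    have hG : (a * b - f ^ 2) * (a * c - e ^ 2) - (a * d - e * f) ^ 2 = a := by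
      linear_combination a * hdet
    obtain ⟨α, γ, ⟨δ, β, hαγ⟩, hle⟩ :=
      exists_isCoprime_binary_form_small (a * b - f ^ 2) (a * d - e * f) (a * c - e ^ 2) hab
        (by rw [hG]; exact ha)
    rw [hG] at hle
    obtain ⟨k, hk⟩ := exists_two_mul_add_mul_sq_le a (f * α + e * γ) ha
    obtain ⟨l, hl⟩ := exists_two_mul_add_mul_sq_le a (-f * β + e * δ) ha
    obtain ⟨Y, Z, hy, hz⟩ : ∃ Y Z : ℤ, y = α * Y - β * Z ∧ z = γ * Y + δ * Z :=
      ⟨δ * y + β * z, -γ * y + α * z, by linear_combination (-y) * hαγ,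
        by linear_combination (-z) * hαγ⟩
    obtain ⟨X, hx⟩ : ∃ X : ℤ, x = X + k * Y + l * Z := ⟨x - k * Y - l * Z, by ring⟩
    obtain ⟨f', hf'⟩ : ∃ f' : ℤ, f' = f * α + e * γ + k * a := ⟨_, rfl⟩
    obtain ⟨e', he'⟩ : ∃ e' : ℤ, e' = -f * β + e * δ + l * a := ⟨_, rfl⟩
    obtain ⟨b', hb'⟩ : ∃ b' : ℤ, b' = b * α ^ 2 + 2 * d * α * γ + c * γ ^ 2
      + 2 * k * (f * α + e * γ) + k ^ 2 * a := ⟨_, rfl⟩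
    obtain ⟨c', hc'⟩ : ∃ c' : ℤ, c' = b * β ^ 2 - 2 * d * β * δ + c * δ ^ 2
      + 2 * l * (-f * β + e * δ) + l ^ 2 * a := ⟨_, rfl⟩
    obtain ⟨d', hd'⟩ : ∃ d' : ℤ, d' = -b * α * β + d * (α * δ - β * γ) + c * γ * δ
      + l * (f * α + e * γ) + k * (-f * β + e * δ) + k * l * a := ⟨_, rfl⟩
    have hQ : a * x ^ 2 + b * y ^ 2 + c * z ^ 2 + 2 * d * y * z + 2 * e * x * z + 2 * f * x * y
        = a * X ^ 2 + b' * Y ^ 2 + c' * Z ^ 2 + 2 * d' * Y * Z + 2 * e' * X * Z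
          + 2 * f' * X * Y := by
      rw [hx, hy, hz, hb', hc', hd', he', hf']; ring
    have hdet' : a * b' * c' + 2 * d' * e' * f' - a * d' ^ 2 - b' * e' ^ 2 - c' * f' ^ 2 = 1 := by
      have : a * b' * c' + 2 * d' * e' * f' - a * d' ^ 2 - b' * e' ^ 2 - c' * f' ^ 2
          = (a * b * c + 2 * d * e * f - a * d ^ 2 - b * e ^ 2 - c * f ^ 2)
            * (δ * α + β * γ) ^ 2 := by
        rw [hb', hc', hd', he', hf']; ring
      rw [this, hdet, hαγ]; norm_num
    obtain ⟨p, hp⟩ : ∃ p : ℤ, p = a * b' - f' ^ 2 := ⟨_, rfl⟩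
    have hpG : p = (a * b - f ^ 2) * α ^ 2 + 2 * (a * d - e * f) * α * γ
        + (a * c - e ^ 2) * γ ^ 2 := by
      rw [hp, hb', hf']; ring
    rw [← hpG] at hle
    rw [← hf'] at hk
    rw [← he'] at hl
    have hp0 : 0 < p := by
      have h1 : (a * b - f ^ 2) * p
          = ((a * b - f ^ 2) * α + (a * d - e * f) * γ) ^ 2 + a * γ ^ 2 := by
        rw [hpG]; linear_combination γ ^ 2 * hG
      have h2 : 0 < (a * b - f ^ 2) * p := by
        rw [h1]
        by_cases hγ : γ = 0
        · have hα : α ≠ 0 := by rintro rfl; simp [hγ] at hαγ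
          subst hγ
          have : 0 < ((a * b - f ^ 2) * α) ^ 2 := by positivity
          simpa using this
        · positivity
      exact pos_of_mul_pos_right h2 hab.le
    have hb0 : 0 < b' := by
      have : 0 < a * b' := by linarith [sq_nonneg f']
      exact pos_of_mul_pos_right this ha.le
    rw [hQ]
    by_cases hlt : b' < a
    · obtain ⟨u, v, w, h⟩ := ih b'.toNat (by omega) b' a c' e' d' f' hb0 (by linarith)
        (by linear_combination hdet') Y X Z rfl
      exact ⟨u, v, w, by linear_combination h⟩
    -- No descent is possible: `3a² ≤ 4p` and `3p² ≤ 4a` give `27a³ ≤ 64`, so `a = 1`.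
    · push Not at hlt
      have h1 : 3 * a ^ 2 ≤ 4 * p := by
        have := mul_le_mul_of_nonneg_left hlt ha.le
        linarith
      have h2 : a = 1 := by
        have h3 : 9 * a ^ 4 ≤ 16 * p ^ 2 := by
          have := pow_le_pow_left₀ (by positivity) h1 2
          linarith [this, show (3 * a ^ 2) ^ 2 = 9 * a ^ 4 by ring,
            show (4 * p) ^ 2 = 16 * p ^ 2 by ring]
        by_contra h
        have h4 : 2 ≤ a := by omega
        have h5 : 2 ^ 3 ≤ a ^ 3 := pow_le_pow_left₀ (by norm_num) h4 3
        have h6 := mul_le_mul_of_nonneg_right h5 ha.le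
        linarith [show a ^ 3 * a = a ^ 4 by ring]
      subst h2
      have hf0 : f' = 0 := Int.abs_lt_one_iff.mp ((sq_lt_one_iff_abs_lt_one _).mp (by linarith))
      have he0 : e' = 0 := Int.abs_lt_one_iff.mp ((sq_lt_one_iff_abs_lt_one _).mp (by linarith))
      have hp1 : p = 1 := by
        have : p < 2 := lt_of_pow_lt_pow_left₀ 2 (by norm_num) (by linarith)
        omega
      subst hf0 he0
      have hb1 : b' = 1 := by linarith
      subst hb1
      refine ⟨X, Y + d' * Z, Z, ?_⟩
      linear_combination Z ^ 2 * hdet'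

/-! ### Three squares and Cauchy's lemma -/

open scoped NumberTheorySymbols in
/-- **Three squares theorem** for integers congruent to `3` modulo `8`. -/
theorem exists_sum_three_sq_of_mod_eight_eq_three (n : ℕ) (hn : n % 8 = 3) :
    ∃ x y z : ℤ, (n : ℤ) = x ^ 2 + y ^ 2 + z ^ 2 := by
  obtain ⟨t, rfl⟩ : ∃ t, n = 8 * t + 3 := ⟨n / 8, by omega⟩
  have hcop : (4 * t + 1).Coprime (4 * (8 * t + 3)) := by
    rw [← Nat.isCoprime_iff_coprime]
    exact ⟨8 * t + 1, -t, by push_cast; ring⟩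
  -- This class gives `2p = (8j + 1)n - 1`, so `-2p ≡ 1` modulo `8j + 1`; with `p ≡ 1 mod 4`,
  -- reciprocity makes `-(8j + 1)` a square modulo `p`.
  obtain ⟨p, hpgt, hp, hmod⟩ :=
    Nat.forall_exists_prime_gt_and_modEq (4 * t + 1) (by positivity) hcop
  obtain ⟨j, hj⟩ : ∃ j, p = 4 * t + 1 + 4 * (8 * t + 3) * j := by
    obtain ⟨j, hj⟩ := (Nat.modEq_iff_dvd' hpgt.le).mp hmod.symm
    exact ⟨j, by omega⟩
  have : Fact p.Prime := ⟨hp⟩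
  have hp4 : p % 4 = 1 := by
    rw [hj, mul_assoc]; omega
  have hbn : (2 * p : ℤ) = (8 * j + 1) * (8 * t + 3) - 1 := by rw [hj]; push_cast; ring
  have hodd : Odd (8 * j + 1) := ⟨4 * j, by ring⟩
  have hJ1 : J(-2 | 8 * j + 1) = 1 := by
    rw [jacobiSym.at_neg_two hodd, ZMod.χ₈'_nat_eq_if_mod_eight]
    have h1 : (8 * j + 1) % 2 ≠ 0 := by omega
    have h2 : (8 * j + 1) % 8 = 1 := by omega
    simp [h1, h2]
  have hJ2 : J(-2 * (p : ℤ) | 8 * j + 1) = 1 := by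
    rw [← jacobiSym.one_left (8 * j + 1)]
    apply jacobiSym.mod_left'
    apply Int.ModEq.symm
    rw [Int.modEq_iff_dvd]
    exact ⟨-(8 * t + 3), by push_cast; linear_combination -hbn⟩
  have hJ : legendreSym p (-(8 * j + 1 : ℕ)) = 1 := by
    rw [jacobiSym.legendreSym.to_jacobiSym, jacobiSym.neg _ (hp.odd_of_ne_two (by omega)),
      ZMod.χ₄_nat_one_mod_four hp4, one_mul,
      ← jacobiSym.quadratic_reciprocity_one_mod_four hp4 hodd]
    rwa [jacobiSym.mul_left, hJ1, one_mul] at hJ2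
  obtain ⟨s, hs⟩ : ∃ s : ℤ, (p : ℤ) ∣ s ^ 2 + (8 * j + 1) := by
    have h0 : ((-(8 * j + 1 : ℕ) : ℤ) : ZMod p) ≠ 0 := by
      intro h
      rw [(legendreSym.eq_zero_iff p _).mpr h] at hJ
      exact zero_ne_one hJ
    obtain ⟨r, hr⟩ := (legendreSym.eq_one_iff p h0).mp hJ
    obtain ⟨s, rfl⟩ := ZMod.intCast_surjective r
    refine ⟨s, (ZMod.intCast_zmod_eq_zero_iff_dvd _ p).mp ?_⟩
    push_cast at hr ⊢
    linear_combination -hr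
  obtain ⟨s, hs, hs2⟩ : ∃ s : ℤ, (p : ℤ) ∣ s ^ 2 + (8 * j + 1) ∧ s % 2 = 1 := by
    rcases Int.emod_two_eq_zero_or_one s with h | h
    · refine ⟨s + p, ?_, by omega⟩
      have : (s + p) ^ 2 + (8 * j + 1) = s ^ 2 + (8 * j + 1) + p * (2 * s + p) := by ring
      rw [this]
      exact dvd_add hs (dvd_mul_right _ _)
    · exact ⟨s, hs, h⟩
  obtain ⟨a, ha⟩ : (2 * p : ℤ) ∣ s ^ 2 + (8 * j + 1) := by
    refine IsCoprime.mul_dvd ?_ ?_ hs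
    · exact ⟨-(p / 2 : ℤ), 1, by omega⟩
    · obtain ⟨v, rfl⟩ : ∃ v, s = 2 * v + 1 := ⟨s / 2, by omega⟩
      exact ⟨2 * v ^ 2 + 2 * v + 4 * j + 1, by ring⟩
  have hppos : (0 : ℤ) < 2 * p := by have := hp.pos; positivity
  have ha0 : 0 < a := by
    have : 0 < 2 * (p : ℤ) * a := by rw [← ha]; positivity
    exact pos_of_mul_pos_right this hppos.le
  -- The determinant is `n(2pa - s²) - 2p = n(8j + 1) - 2p = 1`, and the value at `(0, 0, 1)` is
  -- `n`.
  obtain ⟨u, v, w, h⟩ := ternary_form_eq_sum_three_sq a (2 * p) (8 * t + 3) 0 1 s ha0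
    (by have : a * (2 * p) - s ^ 2 = 8 * j + 1 := by linear_combination -ha
        rw [this]; positivity)
    (by linear_combination (-(8 * t + 3)) * ha - hbn) 0 0 1
  exact ⟨u, v, w, by rw [← h]; push_cast; ring⟩

/-- **Cauchy's lemma**. -/
theorem exists_nat_sum_eq_and_sum_sq_eq (a b : ℤ) (ha : a % 2 = 1) (hb : b % 2 = 1) (hb0 : 0 ≤ b)
    (h1 : b ^ 2 < 4 * a) (h2 : 3 * a < b ^ 2 + 2 * b + 4) :
    ∃ w x y z : ℕ, (w + x + y + z : ℤ) = b ∧ (w ^ 2 + x ^ 2 + y ^ 2 + z ^ 2 : ℤ) = a := by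
  have h8 : (4 * a - b ^ 2) % 8 = 3 := by
    obtain ⟨a', rfl⟩ : ∃ a', a = 2 * a' + 1 := ⟨a / 2, by omega⟩
    obtain ⟨b', rfl⟩ : ∃ b', b = 2 * b' + 1 := ⟨b / 2, by omega⟩
    obtain ⟨c, hc⟩ := Int.even_mul_succ_self b'
    have : 4 * (2 * a' + 1) - (2 * b' + 1) ^ 2 = 8 * (a' - c) + 3 := by linear_combination -4 * hc
    omega
  obtain ⟨x, y, z, hxyz⟩ := exists_sum_three_sq_of_mod_eight_eq_three (4 * a - b ^ 2).toNat
    (by omega)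
  rw [Int.toNat_of_nonneg (by linarith)] at hxyz
  have hsq (m : ℤ) : m % 2 = 0 ∧ (m ^ 2 % 8 = 0 ∨ m ^ 2 % 8 = 4) ∨ m % 2 = 1 ∧ m ^ 2 % 8 = 1 := by
    have h : m % 8 = 0 ∨ m % 8 = 1 ∨ m % 8 = 2 ∨ m % 8 = 3 ∨ m % 8 = 4 ∨ m % 8 = 5 ∨ m % 8 = 6
      ∨ m % 8 = 7 := by omega
    rcases h with h | h | h | h | h | h | h | h <;> simp [pow_two, Int.mul_emod, h] <;> omega
  have hx : x % 2 = 1 := by have := hsq x; have := hsq y; have := hsq z; omega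
  have hy : y % 2 = 1 := by have := hsq x; have := hsq y; have := hsq z; omega
  have hz : z % 2 = 1 := by have := hsq x; have := hsq y; have := hsq z; omega
  obtain ⟨z, hxyz, hz, h4⟩ : ∃ z : ℤ, 4 * a - b ^ 2 = x ^ 2 + y ^ 2 + z ^ 2 ∧ z % 2 = 1 ∧
      (b + x + y + z) % 4 = 0 := by
    by_cases h : (b + x + y + z) % 4 = 0
    · exact ⟨z, hxyz, hz, h⟩
    · exact ⟨-z, by rw [hxyz]; ring, by omega, by omega⟩
  -- By Cauchy–Schwarz `(X + Y + Z)² ≤ 3(4a - b²) < (b + 4)²`. The quotients by 4 below therefore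
  -- exceed `-1`.
  have hbound (X Y Z : ℤ) (h : X ^ 2 + Y ^ 2 + Z ^ 2 = x ^ 2 + y ^ 2 + z ^ 2) :
      -(b + 4) < X + Y + Z := by
    refine (abs_lt.mp (abs_lt_of_sq_lt_sq ?_ (by linarith))).1
    nlinarith [sq_nonneg (X - Y), sq_nonneg (Y - Z), sq_nonneg (X - Z)]
  have hb1 := hbound x y z rfl
  have hb2 := hbound x (-y) (-z) (by ring)
  have hb3 := hbound (-x) y (-z) (by ring)
  have hb4 := hbound (-x) (-y) z (by ring)
  obtain ⟨w₁, hw₁⟩ : ∃ w : ℕ, b + x + y + z = 4 * w := ⟨((b + x + y + z) / 4).toNat, by omega⟩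
  obtain ⟨w₂, hw₂⟩ : ∃ w : ℕ, b + x - y - z = 4 * w := ⟨((b + x - y - z) / 4).toNat, by omega⟩
  obtain ⟨w₃, hw₃⟩ : ∃ w : ℕ, b - x + y - z = 4 * w := ⟨((b - x + y - z) / 4).toNat, by omega⟩
  obtain ⟨w₄, hw₄⟩ : ∃ w : ℕ, b - x - y + z = 4 * w := ⟨((b - x - y + z) / 4).toNat, by omega⟩
  refine ⟨w₁, w₂, w₃, w₄, by linarith, ?_⟩
  have : (4 * w₁ : ℤ) ^ 2 + (4 * w₂) ^ 2 + (4 * w₃) ^ 2 + (4 * w₄) ^ 2 = 16 * a := by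
    rw [← hw₁, ← hw₂, ← hw₃, ← hw₄]
    linear_combination -4 * hxyz
  linarith

/-! ### Large `n` -/

theorem two_mul_sum_secondPolygonalNumber (m : ℤ) (w x y z : ℕ) :
    2 * (secondPolygonalNumber m w + secondPolygonalNumber m x + secondPolygonalNumber m y
        + secondPolygonalNumber m z)
      = (m - 2) * (w ^ 2 + x ^ 2 + y ^ 2 + z ^ 2) + (m - 4) * (w + x + y + z) := by
  linear_combination two_mul_secondPolygonalNumber m w + two_mul_secondPolygonalNumber m x
    + two_mul_secondPolygonalNumber m y + two_mul_secondPolygonalNumber m z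

theorem exists_sum_secondPolygonalNumber_five_of_ge (n : ℤ) (hn : 600 ≤ n) :
    ∃ w x y z : ℕ, secondPolygonalNumber 5 w + secondPolygonalNumber 5 x
      + secondPolygonalNumber 5 y + secondPolygonalNumber 5 z = n := by
  -- This is `3a < b² + 2b + 4` after substituting `3a = 2n - b`.
  have hex : ∃ b : ℕ, 2 * n < b ^ 2 + 3 * b + 4 := ⟨n.toNat, by
    rw [Int.toNat_of_nonneg (by linarith)]; nlinarith⟩
  classical
  obtain ⟨c, hc, hmin⟩ : ∃ c : ℕ, 2 * n < c ^ 2 + 3 * c + 4 ∧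
      ∀ k < c, ¬ 2 * n < k ^ 2 + 3 * k + 4 :=
    ⟨Nat.find hex, Nat.find_spec hex, fun k hk => Nat.find_min hex hk⟩
  -- From 33 on, minimality of `c` forces `b² < 4a` even for `b = c + 5`.
  have hc33 : 33 ≤ c := by
    by_contra! h
    have : (c : ℤ) ≤ 32 := by omega
    nlinarith
  have hc' := hmin (c - 1) (by omega)
  rw [Nat.cast_sub (by omega)] at hc'
  push_cast at hc'
  -- Modulo 6: `b` is odd and `3 ∣ 2n - b`, so `a` is an odd integer.
  obtain ⟨b, hcb, hbc, hb⟩ : ∃ b : ℤ, c ≤ b ∧ b ≤ c + 5 ∧ (b - (3 - 4 * n)) % 6 = 0 := by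
    refine ⟨c + (3 - 4 * n - c) % 6, by omega, by omega, by omega⟩
  obtain ⟨a, ha⟩ : ∃ a, 2 * n = 3 * a + b := ⟨(2 * n - b) / 3, by omega⟩
  have hc33' : (33 : ℤ) ≤ c := by exact_mod_cast hc33
  obtain ⟨w, x, y, z, h1, h2⟩ := exists_nat_sum_eq_and_sum_sq_eq a b (by omega) (by omega)
    (by omega) (by nlinarith) (by nlinarith)
  refine ⟨w, x, y, z, ?_⟩
  have := two_mul_sum_secondPolygonalNumber 5 w x y z
  rw [h1, h2] at this
  linarith

theorem exists_sum_secondPolygonalNumber_seven_of_ge (n : ℤ) (hn : 3100 ≤ n) :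
    ∃ w x y z : ℕ, secondPolygonalNumber 7 w + secondPolygonalNumber 7 x
      + secondPolygonalNumber 7 y + secondPolygonalNumber 7 z = n := by
  have hex : ∃ b : ℕ, 6 * n < 5 * b ^ 2 + 19 * b + 20 := ⟨n.toNat, by
    rw [Int.toNat_of_nonneg (by linarith)]; nlinarith⟩
  classical
  obtain ⟨c, hc, hmin⟩ : ∃ c : ℕ, 6 * n < 5 * c ^ 2 + 19 * c + 20 ∧
      ∀ k < c, ¬ 6 * n < 5 * k ^ 2 + 19 * k + 20 :=
    ⟨Nat.find hex, Nat.find_spec hex, fun k hk => Nat.find_min hex hk⟩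
  -- As before, 60 is where `b² < 4a` holds up to `b = c + 9`.
  have hc60 : 60 ≤ c := by
    by_contra! h
    have : (c : ℤ) ≤ 59 := by omega
    nlinarith
  have hc' := hmin (c - 1) (by omega)
  rw [Nat.cast_sub (by omega)] at hc'
  push_cast at hc'
  obtain ⟨b, hcb, hbc, hb⟩ : ∃ b : ℤ, c ≤ b ∧ b ≤ c + 9 ∧ (b - (5 + 4 * n)) % 10 = 0 := by
    refine ⟨c + (5 + 4 * n - c) % 10, by omega, by omega, by omega⟩
  obtain ⟨a, ha⟩ : ∃ a, 2 * n = 5 * a + 3 * b := ⟨(2 * n - 3 * b) / 5, by omega⟩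
  have hc60' : (60 : ℤ) ≤ c := by exact_mod_cast hc60
  obtain ⟨w, x, y, z, h1, h2⟩ := exists_nat_sum_eq_and_sum_sq_eq a b (by omega) (by omega)
    (by omega) (by nlinarith) (by nlinarith)
  refine ⟨w, x, y, z, ?_⟩
  have := two_mul_sum_secondPolygonalNumber 7 w x y z
  rw [h1, h2] at this
  linarith

/-! ### Small `n` by bitmasks -/

/-- The bitmask of the set of all `i + f j` with `i` in the set of bits of `M` and `j < k`. -/
def addMask (f : ℕ → ℕ) (M : ℕ) : ℕ → ℕ
  | 0 => 0
  | k + 1 => addMask f M k ||| M <<< f k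

theorem testBit_addMask (f : ℕ → ℕ) (M k n : ℕ) :
    (addMask f M k).testBit n = true ↔ ∃ i < k, ∃ r, M.testBit r = true ∧ n = r + f i := by
  induction k with
  | zero => simp [addMask]
  | succ k ih =>
    rw [addMask, Nat.testBit_or, Bool.or_eq_true, ih, Nat.testBit_shiftLeft, Bool.and_eq_true,
      decide_eq_true_eq]
    constructor
    · rintro (⟨i, hi, r, hr⟩ | ⟨h1, h2⟩)
      · exact ⟨i, by omega, r, hr⟩
      · exact ⟨k, by omega, n - f k, h2, by omega⟩
    · rintro ⟨i, hi, r, hr, rfl⟩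
      rcases Nat.lt_succ_iff_lt_or_eq.mp hi with h | rfl
      · exact Or.inl ⟨i, h, r, hr, rfl⟩
      · exact Or.inr ⟨by omega, by simpa using hr⟩

/-- The bitmask of the set of all sums of four values of `f` at arguments below `k`. -/
def fourSumMask (f : ℕ → ℕ) (k : ℕ) : ℕ :=
  addMask f (addMask f (addMask f (addMask f 1 k) k) k) k

theorem testBit_fourSumMask (f : ℕ → ℕ) (k n : ℕ) :
    (fourSumMask f k).testBit n = true ↔
      ∃ w < k, ∃ x < k, ∃ y < k, ∃ z < k, f w + f x + f y + f z = n := by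
  simp only [fourSumMask, testBit_addMask, Nat.testBit_one_eq_true_iff_self_eq_zero]
  constructor
  · rintro ⟨z, hz, _, ⟨y, hy, _, ⟨x, hx, _, ⟨w, hw, _, rfl, rfl⟩, rfl⟩, rfl⟩, rfl⟩
    exact ⟨w, hw, x, hx, y, hy, z, hz, by omega⟩
  · rintro ⟨w, hw, x, hx, y, hy, z, hz, rfl⟩
    exact ⟨z, hz, _, ⟨y, hy, _, ⟨x, hx, _, ⟨w, hw, 0, rfl, rfl⟩, rfl⟩, rfl⟩, by omega⟩

theorem secondPolygonalNumber_five (i : ℕ) :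
    secondPolygonalNumber 5 i = (i * (3 * i + 1) / 2 : ℕ) := by
  have := two_mul_secondPolygonalNumber 5 i
  push_cast
  have h : (i : ℤ) * (3 * i + 1) = 2 * secondPolygonalNumber 5 i := by rw [this]; ring
  omega

theorem secondPolygonalNumber_seven (i : ℕ) :
    secondPolygonalNumber 7 i = (i * (5 * i + 3) / 2 : ℕ) := by
  have := two_mul_secondPolygonalNumber 7 i
  push_cast
  have h : (i : ℤ) * (5 * i + 3) = 2 * secondPolygonalNumber 7 i := by rw [this]; ring
  omega

set_option maxRecDepth 20000 in
theorem fourSumMask_five : ∀ n < 600, (fourSumMask (fun i => i * (3 * i + 1) / 2) 20).testBit n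
    = decide (n ∉ [1, 3, 5, 10, 12, 20, 25, 27, 38, 53, 65, 153, 165]) := by
  decide +kernel

theorem fourSumMask_seven :
    -- Bits 786 to 3099 are all set: `2314 = 3100 - 786`.
    (fourSumMask (fun i => i * (5 * i + 3) / 2) 36 >>> 786) % 2 ^ 2314 = 2 ^ 2314 - 1 := by
  decide +kernel

theorem exists_sum_secondPolygonalNumber_five_iff_of_lt (n : ℕ) (hn : n < 600) :
    (∃ w x y z : ℕ, secondPolygonalNumber 5 w + secondPolygonalNumber 5 x
      + secondPolygonalNumber 5 y + secondPolygonalNumber 5 z = n) ↔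
      n ∉ [1, 3, 5, 10, 12, 20, 25, 27, 38, 53, 65, 153, 165] := by
  rw [← decide_eq_true_iff (p := n ∉ _), ← fourSumMask_five n hn, testBit_fourSumMask]
  simp only [secondPolygonalNumber_five]
  norm_cast
  constructor
  · rintro ⟨w, x, y, z, h⟩
    -- The value at 20 is 610, so arguments below 20 suffice.
    have hlt (i : ℕ) (hi : i * (3 * i + 1) / 2 < 600) : i < 20 := by
      by_contra! h'
      have : 20 * (3 * 20 + 1) ≤ i * (3 * i + 1) := by gcongr
      omega
    exact ⟨w, hlt w (by omega), x, hlt x (by omega), y, hlt y (by omega), z, hlt z (by omega), h⟩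
  · rintro ⟨w, -, x, -, y, -, z, -, h⟩
    exact ⟨w, x, y, z, h⟩

theorem exists_sum_secondPolygonalNumber_seven_of_lt (n : ℕ) (h1 : 786 ≤ n) (h2 : n < 3100) :
    ∃ w x y z : ℕ, secondPolygonalNumber 7 w + secondPolygonalNumber 7 x
      + secondPolygonalNumber 7 y + secondPolygonalNumber 7 z = n := by
  have h := congrArg (fun M => M.testBit (n - 786)) fourSumMask_seven
  simp only [Nat.testBit_mod_two_pow, Nat.testBit_two_pow_sub_one, Nat.testBit_shiftRight] at h
  rw [decide_eq_true (by omega : n - 786 < 2314), Bool.true_and, Nat.add_sub_cancel' h1,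
    testBit_fourSumMask] at h
  obtain ⟨w, -, x, -, y, -, z, -, h⟩ := h
  refine ⟨w, x, y, z, ?_⟩
  simp only [secondPolygonalNumber_seven]
  exact_mod_cast h

theorem corollary1p1 :
    {k : ℤ | ∃ w x y z : ℕ,
        secondPolygonalNumber 5 w + secondPolygonalNumber 5 x
          + secondPolygonalNumber 5 y + secondPolygonalNumber 5 z = k}
      = {k : ℤ | 0 ≤ k} \ {1, 3, 5, 10, 12, 20, 25, 27, 38, 53, 65, 153, 165} ∧
    ∀ n : ℤ, 786 ≤ n → ∃ w x y z : ℕ,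
      n = secondPolygonalNumber 7 w + secondPolygonalNumber 7 x
        + secondPolygonalNumber 7 y + secondPolygonalNumber 7 z := by
  constructor
  · ext k
    simp only [Set.mem_ofPred_eq, Set.mem_sdiff, Set.mem_insert_iff, Set.mem_singleton_iff]
    by_cases hk0 : k < 0
    · refine ⟨?_, fun h => by omega⟩
      rintro ⟨w, x, y, z, h⟩
      simp only [secondPolygonalNumber_five] at h
      omega
    by_cases hk : 600 ≤ k
    · exact ⟨fun _ => by omega, fun _ => exists_sum_secondPolygonalNumber_five_of_ge k hk⟩
    lift k to ℕ using by omega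
    rw [exists_sum_secondPolygonalNumber_five_iff_of_lt k (by omega)]
    simp only [List.mem_cons, List.not_mem_nil, or_false]
    omega
  · intro n hn
    obtain ⟨w, x, y, z, h⟩ : ∃ w x y z : ℕ, secondPolygonalNumber 7 w + secondPolygonalNumber 7 x
        + secondPolygonalNumber 7 y + secondPolygonalNumber 7 z = n := by
      by_cases hn' : 3100 ≤ n
      · exact exists_sum_secondPolygonalNumber_seven_of_ge n hn'
      · lift n to ℕ using by omega
        exact exists_sum_secondPolygonalNumber_seven_of_lt n (by omega) (by omega)
    exact ⟨w, x, y, z, h.symm⟩
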